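/- Let $f$ be a neural network with layers $f_0,\dots,f_L$ ($f_L$ the lowest) and fixed parameter $\theta$, evaluated on a random data input $x=f_{L+1}$, and let $0\le l\le L$. Let $d\ge 1$, and let $f_l$ and $f_{l+1}$ take values in $\mathbb{R}^{d+1}$. Assume that the activation lengths are fixed, $\|f_{l+1}\|_2=c_{l+1}>0$ and $\|f_l\|_2=c_l>0$ almost surely, and that the random vectors $f_{l+1}$ and $f_l$ have probability density functions $p_{l+1}$ and $p_l$ with respect to surface measure on the $d$-dimensional hyperspheres of radii $c_{l+1}$ and $c_l$ about the origin. Assume that the layer function $f_l$ is almost surely differentiable at $f_{l+1}$, and let $\mathcal J$ be its Jacobian with respect to $f_{l+1}$ varying in the hypersphere, i.e. the restriction of its derivative at $f_{l+1}$ to the $d$-dimensional tangent space $f_{l+1}^{\perp}$. Let $s_1,\dots,s_d$ be the singular values of $\mathcal J$, let $\mu_{|s|}$ and $\sigma_{|s|}$ be their mean and (population) standard deviation, and put $$\|\mathcal J\|_{qm}=\sqrt{\tfrac1d\textstyle\sum_i s_i^2},\qquad GSC(l+1,l)=\frac{\|\mathcal J\|_{qm}\,\|f_{l+1}\|_2}{\|f_l\|_2}.$$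 For $k\in\{l,l+1\}$ let $H(f_k)=\mathbb E[-\log p_k(f_k)]$ be the entropy and $E(f_k)=\mathbb E[p_k(f_k)^{-1/d}]$ the exponential entropy. Let $\epsilon\ge 0$ and assume that $\sigma_{|s|}\ge\sqrt{\epsilon(\epsilon+2\mu_{|s|})}$ with probability at least $\delta$. (1) If $H(f_{l+1})$ and $H(f_l)$ exist and are finite, then $$\mathbb E\,GSC(l+1,l)\ \ge\ \frac{c_{l+1}}{c_l}\,\epsilon\delta+\exp\Big(\tfrac1d\big((H(f_l)-d\log c_l)-(H(f_{l+1})-d\log c_{l+1})\big)\Big).$$ (2) If the value $p_{l+1}(f_{l+1})$ of the density is independent of the singular values of $\mathcal J$, then $$\mathbb E\,GSC(l+1,l)\ \ge\ \frac{c_{l+1}}{c_l}\,\epsilon\delta+\frac{E(f_l)/c_l}{E(f_{l+1})/c_{l+1}}.$$ The expectations of the nonnegative quantities $GSC$ and $p_k(f_k)^{-1/d}$ are taken in $[0,\infty]$. -/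

import Mathlib

open MeasureTheory ProbabilityTheory
open scoped ENNReal

noncomputable section

/-! ### Singular value statistics of a linear map -/

section SingularValues

variable {V W : Type*} [NormedAddCommGroup V] [InnerProductSpace ℝ V] [FiniteDimensional ℝ V]
  [NormedAddCommGroup W] [InnerProductSpace ℝ W] [FiniteDimensional ℝ W]

/-- The quadratic mean norm: the root of the sum of the squared singular values divided by the
number of columns, i.e. by the dimension of the domain. (Singular values with an index beyond the
dimension of the domain or of the codomain vanish.) -/
def qmNorm (A : V →ₗ[ℝ] W) : ℝ :=
  √((∑ i ∈ Finset.range (Module.finrank ℝ V), A.singularValues i ^ 2) / Module.finrank ℝ V)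

/-- Mean of the singular values. -/
def meanSV (A : V →ₗ[ℝ] W) : ℝ :=
  (∑ i ∈ Finset.range (Module.finrank ℝ V), A.singularValues i) / Module.finrank ℝ V

/-- Standard deviation of the singular values. -/
def stdSV (A : V →ₗ[ℝ] W) : ℝ :=
  √((∑ i ∈ Finset.range (Module.finrank ℝ V), (A.singularValues i - meanSV A) ^ 2) /
      Module.finrank ℝ V)

end SingularValues

/-! ### Hyperspheres -/

/-- The surface area measure of the hypersphere of radius `c` about the origin of `ℝ ^ n`, as a
measure on `ℝ ^ n`: the surface measure of the unit sphere, pushed forward under scaling by `c`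
and multiplied by `c ^ (n - 1)`. -/
def sphereMeasure (n : ℕ) (c : ℝ) : Measure (EuclideanSpace ℝ (Fin n)) :=
  ENNReal.ofReal (c ^ (n - 1)) •
    Measure.map (fun u : Metric.sphere (0 : EuclideanSpace ℝ (Fin n)) 1 => c • u.1)
      (volume : Measure (EuclideanSpace ℝ (Fin n))).toSphere

/-- The tangent space at `v` of the hypersphere about the origin through `v`. -/
abbrev sphereTangent {n : ℕ} (v : EuclideanSpace ℝ (Fin n)) :
    Submodule ℝ (EuclideanSpace ℝ (Fin n)) :=
  (ℝ ∙ v)ᗮ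

/-- The Jacobian at `v` of the restriction of `g` to the hypersphere through `v`: the derivative
of `g` at `v`, restricted to the tangent space. -/
def sphereJacobian {n m : ℕ} (g : EuclideanSpace ℝ (Fin n) → EuclideanSpace ℝ (Fin m))
    (v : EuclideanSpace ℝ (Fin n)) : sphereTangent v →ₗ[ℝ] EuclideanSpace ℝ (Fin m) :=
  (fderiv ℝ g v : EuclideanSpace ℝ (Fin n) →ₗ[ℝ] EuclideanSpace ℝ (Fin m)) ∘ₗ
    (sphereTangent v).subtype

/-! ### Entropy and exponential entropy -/

section Entropy

variable {Ω E : Type*} [MeasurableSpace Ω] [MeasurableSpace E]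

/-- Minus the logarithm of the density `p` of `X` with respect to `ν`, evaluated at `X`. -/
def infoContent (X : Ω → E) (P : Measure Ω) (ν : Measure E) (ω : Ω) : ℝ :=
  -Real.log (pdf X P ν (X ω)).toReal

/-- The entropy `H(X) = 𝔼[- log p(X)]` is a finite expectation. -/
def HasEntropy (X : Ω → E) (P : Measure Ω) (ν : Measure E) : Prop :=
  Integrable (infoContent X P ν) P

/-- The entropy `H(X) = 𝔼[- log p(X)]`, where `p` is the density of `X` with respect to `ν`. -/
def entropy (X : Ω → E) (P : Measure Ω) (ν : Measure E) : ℝ :=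
  ∫ ω, infoContent X P ν ω ∂P

/-- The exponential entropy `E(X) = 𝔼[p(X) ^ (-1 / d)]` in dimension `d`, where `p` is the density
of `X` with respect to `ν`. -/
def expEntropy (d : ℕ) (X : Ω → E) (P : Measure Ω) (ν : Measure E) : ℝ≥0∞ :=
  ∫⁻ ω, pdf X P ν (X ω) ^ (-(1 / (d : ℝ))) ∂P

end Entropy

/-! ### Neural networks -/

/-- A neural network with layers `f_0, …, f_L`, `L = depth`, where `f_0` is the highest layer and
`f_L` the lowest one. The layer `f_l` takes a parameter `θ_l` (for `l = 0` this is the label) and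
the value of `f_{l+1}`, where `f_{L+1}` is the data input. Layers with index above `depth` play no
role. -/
structure NeuralNetwork where
  /-- The nominal depth `L`. -/
  depth : ℕ
  /-- The widths `d_0, …, d_{L+1}`. -/
  width : ℕ → ℕ
  /-- The space of parameters of a layer. -/
  Param : ℕ → Type
  /-- The layer functions. -/
  layer : (l : ℕ) → Param l →
    EuclideanSpace ℝ (Fin (width (l + 1))) → EuclideanSpace ℝ (Fin (width l))

namespace NeuralNetwork

variable (N : NeuralNetwork)

/-- The space of values of `f_l`. -/
abbrev Space (l : ℕ) : Type := EuclideanSpace ℝ (Fin (N.width l))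

/-- `f_l` as a function of `f_k`, `l ≤ k`: the composition `f_l ∘ f_{l+1} ∘ ⋯ ∘ f_{k-1}`. -/
def between (θ : ∀ l, N.Param l) (l k : ℕ) (h : l ≤ k) : N.Space k → N.Space l :=
  Nat.leRecOn (C := fun k => N.Space k → N.Space l) h
    (fun {k} g => g ∘ N.layer k (θ k)) id

theorem between_self (θ : ∀ l, N.Param l) (l : ℕ) : N.between θ l l le_rfl = id :=
  Nat.leRecOn_self _

theorem between_succ (θ : ∀ l, N.Param l) (l k : ℕ) (h : l ≤ k) :
    N.between θ l (k + 1) (Nat.le_succ_of_le h) = N.between θ l k h ∘ N.layer k (θ k) :=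
  Nat.leRecOn_succ h _

/-- The value of `f_l` on the data input `x`. -/
def act (θ : ∀ l, N.Param l) (l : ℕ) (h : l ≤ N.depth + 1) (x : N.Space (N.depth + 1)) :
    N.Space l :=
  N.between θ l (N.depth + 1) h x

/-- The Jacobian `J^l_k` of `f_l` with respect to `f_k` at the data input `x`, where `f_k` varies
in the hypersphere of vectors of its length. -/
def jacobian (θ : ∀ l, N.Param l) (k l : ℕ) (hlk : l ≤ k) (hk : k ≤ N.depth + 1)
    (x : N.Space (N.depth + 1)) : sphereTangent (N.act θ k hk x) →ₗ[ℝ] N.Space l :=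
  sphereJacobian (N.between θ l k hlk) (N.act θ k hk x)

/-- The gradient scale coefficient `GSC(k, l) = ‖J^l_k‖_qm ‖f_k‖ / ‖f_l‖` for activation vectors
that vary in hyperspheres. -/
def gsc (θ : ∀ l, N.Param l) (k l : ℕ) (hlk : l ≤ k) (hk : k ≤ N.depth + 1)
    (x : N.Space (N.depth + 1)) : ℝ :=
  qmNorm (N.jacobian θ k l hlk hk x) * ‖N.act θ k hk x‖ / ‖N.act θ l (hlk.trans hk) x‖

end NeuralNetwork

end

/-! Write `F` for the layer, `X` for its input, `p` and `q` for the densities of `X` and `F X`. The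
core is a change of variables for a map that need not be injective: almost surely `p (X) ≤ q (F X) *
∏ s_i` (`ae_pdf_le_pdf_mul_prod_singularValues`). It is only an inequality because `q` collects mass
from all preimages. Taking `d`-th roots, AM-GM bounds `(p / q) ^ (1 / d)` by the mean singular
value. For (1), take logarithms and apply Jensen's inequality to `exp`. For (2), bound `q ^ (-1 /
d)` by `p ^ (-1 / d)` times the geometric mean of the `s_i` and factor the expectation by
independence.

The term in `ε` comes from `‖J‖_qm ^ 2 = μ ^ 2 + σ ^ 2`: the spread condition says exactly that
`‖J‖_qm ≥ μ + ε`, while `‖J‖_qm ≥ μ` always holds.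

The change of variables rests on an area inequality between spheres (`sphereMeasure_image_le`).
Extending `F` homogeneously to the ball turns it into the area inequality for Lebesgue measure, with
the determinant bounded by Hadamard's inequality in a basis of right singular vectors. -/

/-! ### Singular values: moments, means and determinants. -/

section SingularValueLemmas

variable {V W : Type*} [NormedAddCommGroup V] [InnerProductSpace ℝ V] [FiniteDimensional ℝ V]
  [NormedAddCommGroup W] [InnerProductSpace ℝ W] [FiniteDimensional ℝ W]

/-- A right singular basis: an orthonormal basis of the domain on whose members the norm of the
image is the corresponding singular value. -/
theorem exists_orthonormalBasis_norm_eq_singularValues (A : V →ₗ[ℝ] W) {d : ℕ}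
    (hd : Module.finrank ℝ V = d) :
    ∃ e : OrthonormalBasis (Fin d) ℝ V,
      (∀ i, ‖A (e i)‖ = A.singularValues i) ∧
      ∀ i, (A.adjoint ∘ₗ A) (e i) = (A.singularValues i ^ 2) • e i := by
  refine ⟨A.isSymmetric_adjoint_comp_self.eigenvectorBasis hd, fun i => ?_, fun i => ?_⟩
  · have h := A.isSymmetric_adjoint_comp_self.apply_eigenvectorBasis hd i
    rw [← sq_eq_sq₀ (norm_nonneg _) (A.singularValues_nonneg i), A.sq_singularValues_fin hd,
      ← real_inner_self_eq_norm_sq, ← LinearMap.adjoint_inner_left, ← LinearMap.comp_apply, h]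
    simp [inner_smul_left]
  · rw [A.isSymmetric_adjoint_comp_self.apply_eigenvectorBasis hd i, A.sq_singularValues_fin hd]
    simp

/-- The traces of the powers of `A† A` are the power sums of the squared singular values. -/
theorem trace_adjoint_comp_self_pow (A : V →ₗ[ℝ] W) {d : ℕ} (hd : Module.finrank ℝ V = d)
    (k : ℕ) :
    LinearMap.trace ℝ V ((A.adjoint ∘ₗ A) ^ k) =
      ∑ i ∈ Finset.range d, (A.singularValues i ^ 2) ^ k := by
  obtain ⟨e, -, he⟩ := exists_orthonormalBasis_norm_eq_singularValues A hd
  have hpow : ∀ i, ((A.adjoint ∘ₗ A) ^ k) (e i) = (A.singularValues i ^ 2) ^ k • e i := by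
    intro i
    induction k with
    | zero => simp
    | succ k ih =>
      rw [pow_succ', Module.End.mul_apply, ih, map_smul, he, smul_smul, ← pow_succ]
  rw [LinearMap.trace_eq_sum_inner _ e, Finset.sum_range]
  refine Finset.sum_congr rfl fun i _ => ?_
  rw [hpow, inner_smul_right, real_inner_self_eq_norm_sq, e.norm_eq_one]
  simp

theorem meanSV_nonneg (A : V →ₗ[ℝ] W) : 0 ≤ meanSV A :=
  div_nonneg (Finset.sum_nonneg fun i _ => A.singularValues_nonneg i) (Nat.cast_nonneg _)

theorem qmNorm_nonneg (A : V →ₗ[ℝ] W) : 0 ≤ qmNorm A := Real.sqrt_nonneg _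

/-- The second moment of the singular values is the square of their mean plus their variance. -/
theorem qmNorm_sq (A : V →ₗ[ℝ] W) (hV : 0 < Module.finrank ℝ V) :
    qmNorm A ^ 2 = meanSV A ^ 2 + stdSV A ^ 2 := by
  have hd : (Module.finrank ℝ V : ℝ) ≠ 0 := by positivity
  rw [qmNorm, stdSV, Real.sq_sqrt (by positivity), Real.sq_sqrt (by positivity)]
  have h : ∑ i ∈ Finset.range (Module.finrank ℝ V), A.singularValues i =
      meanSV A * Module.finrank ℝ V := by rw [meanSV]; field_simp
  simp only [sub_sq, Finset.sum_add_distrib, Finset.sum_sub_distrib, ← Finset.sum_mul,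
    ← Finset.mul_sum, h]
  simp only [Finset.sum_const, Finset.card_range, nsmul_eq_mul]
  field_simp
  ring

theorem meanSV_le_qmNorm (A : V →ₗ[ℝ] W) (hV : 0 < Module.finrank ℝ V) :
    meanSV A ≤ qmNorm A := by
  refine le_of_sq_le_sq ?_ (qmNorm_nonneg A)
  rw [qmNorm_sq A hV]
  nlinarith [sq_nonneg (stdSV A)]

/-- The radicand is `(ε + μ) ^ 2 - μ ^ 2`, and the variance is `qmNorm A ^ 2 - μ ^ 2`. -/
theorem sqrt_le_stdSV_iff (A : V →ₗ[ℝ] W) (hV : 0 < Module.finrank ℝ V) {ε : ℝ} (hε : 0 ≤ ε) :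
    √(ε * (ε + 2 * meanSV A)) ≤ stdSV A ↔ ε + meanSV A ≤ qmNorm A := by
  have hm := meanSV_nonneg A
  have hs : 0 ≤ stdSV A := Real.sqrt_nonneg _
  rw [Real.sqrt_le_left hs,
    ← sq_le_sq₀ (add_nonneg hε hm) (qmNorm_nonneg A), qmNorm_sq A hV]
  constructor <;> intro h <;> nlinarith

/-- The geometric mean of the singular values is at most their arithmetic mean. -/
theorem prod_singularValues_rpow_le_meanSV (A : V →ₗ[ℝ] W) {d : ℕ} (hd : 0 < d)
    (hV : Module.finrank ℝ V = d) :
    (∏ i ∈ Finset.range d, A.singularValues i) ^ (1 / (d : ℝ)) ≤ meanSV A := by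
  have h := Real.geom_mean_le_arith_mean (Finset.range d) (fun _ => 1) A.singularValues
    (fun _ _ => zero_le_one) (by simpa using hd) (fun i _ => A.singularValues_nonneg i)
  simpa [meanSV, hV] using h

end SingularValueLemmas

/-- Hadamard's inequality in an orthonormal basis that consists of the direction of `v` and of
right singular vectors of a map on the orthogonal complement of `v`. -/
theorem abs_det_le_norm_mul_prod_singularValues {d : ℕ} {W : Type*} [NormedAddCommGroup W]
    [InnerProductSpace ℝ W] [FiniteDimensional ℝ W]
    (M : EuclideanSpace ℝ (Fin (d + 1)) →ₗ[ℝ] EuclideanSpace ℝ (Fin (d + 1)))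
    (u v : EuclideanSpace ℝ (Fin (d + 1))) (hv : v ≠ 0) (hu : ‖u‖ = 1)
    (huv : ∀ w ∈ sphereTangent v, inner ℝ u w = 0)
    (J : sphereTangent v →ₗ[ℝ] W) (c : ℝ)
    (hJ : ∀ w : sphereTangent v, ‖M w‖ = c * ‖J w‖) :
    |LinearMap.det M| ≤ ‖M u‖ * (c ^ d * ∏ i ∈ Finset.range d, J.singularValues i) := by
  have hfin : Module.finrank ℝ (sphereTangent v) = d := by
    have : Fact (Module.finrank ℝ (EuclideanSpace ℝ (Fin (d + 1))) = d + 1) := ⟨by simp⟩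
    exact Submodule.finrank_orthogonal_span_singleton hv
  obtain ⟨e, he, -⟩ := exists_orthonormalBasis_norm_eq_singularValues J hfin
  let b : Fin (d + 1) → EuclideanSpace ℝ (Fin (d + 1)) := Fin.cons u fun i => (e i : _)
  have hb : Orthonormal ℝ b := by
    rw [orthonormal_iff_ite]
    intro i j
    refine Fin.cases ?_ (fun i => ?_) i <;> refine Fin.cases ?_ (fun j => ?_) j
    · simp [b, hu]
    · simpa [b, (Fin.succ_ne_zero j).symm] using huv _ (e j).2
    · rw [real_inner_comm]
      simpa [b] using huv _ (e i).2
    · have := orthonormal_iff_ite.1 e.orthonormal i j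
      simpa [b] using this
  let B := (basisOfOrthonormalOfCardEqFinrank hb (by simp)).toOrthonormalBasis
    (by simpa using hb)
  have hB : ⇑B = b := by simp [B]
  have : Fact (Module.finrank ℝ (EuclideanSpace ℝ (Fin (d + 1))) = d + 1) := ⟨by simp⟩
  -- Hadamard's inequality for the volume form. In the orientation of `B` this form is the
  -- determinant in `B`, so its value on `M ∘ B` is `det M`.
  have h := B.toBasis.orientation.abs_volumeForm_apply_le (M ∘ B)
  rw [B.toBasis.orientation.volumeForm_robust B rfl] at h
  have h2 : B.toBasis.det (M ∘ B) = LinearMap.det M := by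
    rw [← B.coe_toBasis, B.toBasis.det_comp, B.toBasis.det_self, mul_one]
  rw [h2] at h
  refine h.trans_eq ?_
  rw [Fin.prod_univ_succ, Finset.prod_range, hB]
  congr 1
  simp only [Function.comp_apply, b, Fin.cons_succ, hJ, he]
  rw [Finset.prod_mul_distrib]
  simp

/-! ### Measurable dependence of singular values on the base point. -/

section Measurability

variable {n m : ℕ}

theorem finrank_sphereTangent {d : ℕ} (hn : n = d + 1) {v : EuclideanSpace ℝ (Fin n)}
    (hv : v ≠ 0) : Module.finrank ℝ (sphereTangent v) = d := by
  subst hn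
  have : Fact (Module.finrank ℝ (EuclideanSpace ℝ (Fin (d + 1))) = d + 1) := ⟨by simp⟩
  exact Submodule.finrank_orthogonal_span_singleton hv

/-- The orthogonal projection onto the tangent space at `v`, as an endomorphism that is defined by
a formula in `v`. -/
noncomputable def tangentProj (v : EuclideanSpace ℝ (Fin n)) :
    EuclideanSpace ℝ (Fin n) →L[ℝ] EuclideanSpace ℝ (Fin n) :=
  ContinuousLinearMap.id ℝ _ - (‖v‖ ^ 2)⁻¹ • (innerSL ℝ v).smulRight v

/-- The tangent space, hence the domain of the Jacobian, varies with `v`. Writing inclusion after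
its adjoint as an explicit endomorphism of the fixed ambient space makes measurability in `v`
accessible. -/
theorem tangentProj_eq (v : EuclideanSpace ℝ (Fin n)) :
    (tangentProj v : EuclideanSpace ℝ (Fin n) →ₗ[ℝ] EuclideanSpace ℝ (Fin n)) =
      (sphereTangent v).subtype ∘ₗ LinearMap.adjoint (sphereTangent v).subtype := by
  have hadj : LinearMap.adjoint (sphereTangent v).subtype =
      (sphereTangent v).orthogonalProjectionOnto.toLinearMap := by
    symm
    rw [LinearMap.eq_adjoint_iff]
    intro x y
    simp
  rw [hadj]
  ext1 w
  change _ = (sphereTangent v).starProjection w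
  rw [Submodule.starProjection_orthogonal_val, Submodule.starProjection_singleton]
  simp [tangentProj, smul_smul, div_eq_inv_mul]

theorem measurable_tangentProj : Measurable (tangentProj (n := n)) := by
  have h : Measurable fun v : EuclideanSpace ℝ (Fin n) => (innerSL ℝ v).smulRight v := by
    refine Continuous.measurable ?_
    fun_prop
  exact ((by fun_prop : Measurable fun v : EuclideanSpace ℝ (Fin n) =>
    (‖v‖ ^ 2)⁻¹).smul h).const_sub _

/-- Cyclicity of the trace. The exponent must be positive: the zeroth powers have the two dimensions
as traces. -/
theorem trace_conj_pow_succ {V W : Type*} [AddCommGroup V] [Module ℝ V] [FiniteDimensional ℝ V]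
    [AddCommGroup W] [Module ℝ W] [FiniteDimensional ℝ W] (i : V →ₗ[ℝ] W) (j : W →ₗ[ℝ] V)
    (B : W →ₗ[ℝ] W) (k : ℕ) :
    LinearMap.trace ℝ V ((j ∘ₗ B ∘ₗ i) ^ (k + 1)) =
      LinearMap.trace ℝ W ((B ∘ₗ (i ∘ₗ j)) ^ (k + 1)) := by
  have h : ∀ k : ℕ, (j ∘ₗ B ∘ₗ i) ^ (k + 1) = j ∘ₗ (((B ∘ₗ (i ∘ₗ j)) ^ k : W →ₗ[ℝ] W) ∘ₗ (B ∘ₗ i)) := by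
    intro k
    induction k with
    | zero => ext; simp
    | succ k ih =>
      rw [pow_succ', ih, pow_succ' (B ∘ₗ _)]
      rfl
  rw [h, LinearMap.trace_comp_comm', pow_succ]
  rfl

/-- The trace of the `k`-th power of `A† A Q`. -/
noncomputable def tracePow (k : ℕ) (A : EuclideanSpace ℝ (Fin n) →L[ℝ] EuclideanSpace ℝ (Fin m))
    (Q : EuclideanSpace ℝ (Fin n) →L[ℝ] EuclideanSpace ℝ (Fin n)) : ℝ :=
  LinearMap.trace ℝ (EuclideanSpace ℝ (Fin n))
    ((ContinuousLinearMap.adjoint A ∘L A ∘L Q) ^ k :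
      EuclideanSpace ℝ (Fin n) →L[ℝ] EuclideanSpace ℝ (Fin n))

theorem continuous_tracePow (k : ℕ) :
    Continuous (Function.uncurry (tracePow (n := n) (m := m) k)) := by
  have hcont : Continuous fun T : EuclideanSpace ℝ (Fin n) →L[ℝ] EuclideanSpace ℝ (Fin n) =>
      LinearMap.trace ℝ _ (T : EuclideanSpace ℝ (Fin n) →ₗ[ℝ] EuclideanSpace ℝ (Fin n)) :=
    ((LinearMap.trace ℝ (EuclideanSpace ℝ (Fin n))) ∘ₗ
      (ContinuousLinearMap.coeLM ℝ)).continuous_of_finiteDimensional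
  refine hcont.comp (Continuous.pow ?_ k)
  have := (ContinuousLinearMap.adjoint (𝕜 := ℝ) (E := EuclideanSpace ℝ (Fin n))
    (F := EuclideanSpace ℝ (Fin m))).continuous
  fun_prop

/-- The trace of a power of the Gram operator of the Jacobian of `g` at `v`, computed in the
ambient space. -/
noncomputable def gramPowTrace (g : EuclideanSpace ℝ (Fin n) → EuclideanSpace ℝ (Fin m)) (k : ℕ)
    (v : EuclideanSpace ℝ (Fin n)) : ℝ :=
  tracePow k (fderiv ℝ g v) (tangentProj v)

/-- A power sum of the squared singular values of the Jacobian of `g` at `v` is a trace of an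
endomorphism of the ambient space. -/
theorem sum_singularValues_sphereJacobian_pow {d : ℕ} (hn : n = d + 1)
    (g : EuclideanSpace ℝ (Fin n) → EuclideanSpace ℝ (Fin m))
    {v : EuclideanSpace ℝ (Fin n)} (hv : v ≠ 0) (k : ℕ) :
    ∑ i ∈ Finset.range d, ((sphereJacobian g v).singularValues i ^ 2) ^ (k + 1) =
      gramPowTrace g (k + 1) v := by
  rw [← trace_adjoint_comp_self_pow _ (finrank_sphereTangent hn hv)]
  have h := trace_conj_pow_succ (sphereTangent v).subtype
    (LinearMap.adjoint (sphereTangent v).subtype)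
    ((LinearMap.adjoint (fderiv ℝ g v : EuclideanSpace ℝ (Fin n) →ₗ[ℝ] EuclideanSpace ℝ (Fin m)))
      ∘ₗ (fderiv ℝ g v : EuclideanSpace ℝ (Fin n) →ₗ[ℝ] EuclideanSpace ℝ (Fin m))) k
  rw [← tangentProj_eq] at h
  rw [sphereJacobian, LinearMap.adjoint_comp]
  refine Eq.trans ?_ (h.trans ?_)
  · rfl
  · rw [gramPowTrace, tracePow, ContinuousLinearMap.toLinearMap_pow]
    rfl

theorem measurable_gramPowTrace
    (g : EuclideanSpace ℝ (Fin n) → EuclideanSpace ℝ (Fin m)) (k : ℕ) :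
    Measurable (gramPowTrace g k) := by
  have heq : gramPowTrace g k = Function.uncurry (tracePow (n := n) (m := m) k) ∘
      fun v => (fderiv ℝ g v, tangentProj v) := by
    funext v
    rw [gramPowTrace, Function.comp_apply, Function.uncurry_apply_pair]
  rw [heq]
  have h1 : Measurable (fderiv ℝ g) := measurable_fderiv ℝ g
  have h2 : Measurable fun v => (fderiv ℝ g v, tangentProj v) := h1.prodMk measurable_tangentProj
  have h3 : Measurable (Function.uncurry (tracePow (n := n) (m := m) k)) :=
    (continuous_tracePow k).measurable
  have h := Measurable.comp h3 h2
  exact h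

theorem aemeasurable_sum_eval_singularValues_sphereJacobian {d : ℕ} (hn : n = d + 1)
    (g : EuclideanSpace ℝ (Fin n) → EuclideanSpace ℝ (Fin m)) (p : Polynomial ℝ)
    {μ : Measure (EuclideanSpace ℝ (Fin n))} (hμ : ∀ᵐ v ∂μ, v ≠ 0) :
    AEMeasurable (fun v =>
      ∑ i ∈ Finset.range d, p.eval ((sphereJacobian g v).singularValues i ^ 2)) μ := by
  -- The constant coefficient is split off: it is counted `d` times, whereas `gramPowTrace g 0`
  -- equals `n`.
  have hmeas : Measurable fun v => (d : ℝ) * p.coeff 0 +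
      ∑ j ∈ Finset.range p.natDegree, p.coeff (j + 1) * gramPowTrace g (j + 1) v :=
    (Finset.measurable_sum _ fun j _ => (measurable_gramPowTrace g (j + 1)).const_mul _).const_add _
  refine hmeas.aemeasurable.congr ?_
  filter_upwards [hμ] with v hv
  simp only [← sum_singularValues_sphereJacobian_pow hn g hv, Polynomial.eval_eq_sum_range]
  rw [Finset.sum_comm, Finset.sum_range_succ', add_comm]
  simp [Finset.mul_sum]

/-- Sums of a continuous function over the squared singular values of the Jacobian depend
measurably on the base point. -/
theorem aemeasurable_sum_comp_singularValues_sphereJacobian {d : ℕ} (hn : n = d + 1)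
    (g : EuclideanSpace ℝ (Fin n) → EuclideanSpace ℝ (Fin m)) {f : ℝ → ℝ}
    (hf : ContinuousOn f (Set.Ici 0)) {μ : Measure (EuclideanSpace ℝ (Fin n))}
    (hμ : ∀ᵐ v ∂μ, v ≠ 0) :
    AEMeasurable (fun v => ∑ i ∈ Finset.range d, f ((sphereJacobian g v).singularValues i ^ 2))
      μ := by
  -- Weierstrass approximation on the growing intervals `[0, k]` with error `1 / (k + 1)`; any fixed
  -- squared singular value lies in all but finitely many of them.
  have hp : ∀ k : ℕ, ∃ p : Polynomial ℝ, ∀ t ∈ Set.Icc (0 : ℝ) k,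
      |p.eval t - f t| < 1 / ((k : ℝ) + 1) := fun k =>
    exists_polynomial_near_of_continuousOn 0 k f (hf.mono Set.Icc_subset_Ici_self) _
      Nat.one_div_pos_of_nat
  choose p hp using hp
  refine aemeasurable_of_tendsto_metrizable_ae (u := Filter.atTop) (f := fun k v =>
    ∑ i ∈ Finset.range d, (p k).eval ((sphereJacobian g v).singularValues i ^ 2)) ?_ ?_
  · exact fun k => aemeasurable_sum_eval_singularValues_sphereJacobian hn g (p k) hμ
  · refine Filter.Eventually.of_forall fun v => tendsto_finsetSum _ fun i _ => ?_
    set t := (sphereJacobian g v).singularValues i ^ 2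
    rw [tendsto_iff_dist_tendsto_zero]
    refine squeeze_zero' (Filter.Eventually.of_forall fun _ => dist_nonneg) ?_
      tendsto_one_div_add_atTop_nhds_zero_nat
    filter_upwards [Filter.eventually_ge_atTop ⌈t⌉₊] with k hk
    rw [Real.dist_eq]
    exact (hp k t ⟨sq_nonneg _, Nat.ceil_le.1 hk⟩).le

theorem aemeasurable_meanSV_sphereJacobian {d : ℕ} (hn : n = d + 1)
    (g : EuclideanSpace ℝ (Fin n) → EuclideanSpace ℝ (Fin m))
    {μ : Measure (EuclideanSpace ℝ (Fin n))} (hμ : ∀ᵐ v ∂μ, v ≠ 0) :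
    AEMeasurable (fun v => meanSV (sphereJacobian g v)) μ := by
  refine ((aemeasurable_sum_comp_singularValues_sphereJacobian hn g
    Real.continuous_sqrt.continuousOn hμ).div_const (d : ℝ)).congr ?_
  filter_upwards [hμ] with v hv
  simp [meanSV, finrank_sphereTangent hn hv, Real.sqrt_sq (LinearMap.singularValues_nonneg _ _)]

theorem aemeasurable_qmNorm_sphereJacobian {d : ℕ} (hn : n = d + 1)
    (g : EuclideanSpace ℝ (Fin n) → EuclideanSpace ℝ (Fin m))
    {μ : Measure (EuclideanSpace ℝ (Fin n))} (hμ : ∀ᵐ v ∂μ, v ≠ 0) :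
    AEMeasurable (fun v => qmNorm (sphereJacobian g v)) μ := by
  refine ((aemeasurable_sum_comp_singularValues_sphereJacobian hn g
    continuousOn_id hμ).div_const (d : ℝ)).sqrt.congr ?_
  filter_upwards [hμ] with v hv
  simp [qmNorm, finrank_sphereTangent hn hv]

/-- The product becomes a sum through logarithms. Adding `1 / (k + 1)` to the squares keeps the
logarithm continuous where singular values vanish; then `k` tends to infinity. -/
theorem aemeasurable_prod_singularValues_sphereJacobian {d : ℕ} (hn : n = d + 1)
    (g : EuclideanSpace ℝ (Fin n) → EuclideanSpace ℝ (Fin m))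
    {μ : Measure (EuclideanSpace ℝ (Fin n))} (hμ : ∀ᵐ v ∂μ, v ≠ 0) :
    AEMeasurable (fun v => ∏ i ∈ Finset.range d, (sphereJacobian g v).singularValues i) μ := by
  refine aemeasurable_of_tendsto_metrizable_ae (u := Filter.atTop) (f := fun (k : ℕ) v =>
    √(Real.exp (∑ i ∈ Finset.range d,
      Real.log ((sphereJacobian g v).singularValues i ^ 2 + 1 / ((k : ℝ) + 1))))) ?_ ?_
  · intro k
    refine (Real.measurable_exp.comp_aemeasurable
      (aemeasurable_sum_comp_singularValues_sphereJacobian hn g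
        (f := fun t => Real.log (t + 1 / ((k : ℝ) + 1))) ?_ hμ)).sqrt
    refine ContinuousOn.log (by fun_prop) fun t ht => ?_
    have : 0 < 1 / ((k : ℝ) + 1) := Nat.one_div_pos_of_nat
    exact (add_pos_of_nonneg_of_pos ht this).ne'
  · refine Filter.Eventually.of_forall fun v => ?_
    have h : ∀ k : ℕ, √(Real.exp (∑ i ∈ Finset.range d,
        Real.log ((sphereJacobian g v).singularValues i ^ 2 + 1 / ((k : ℝ) + 1)))) =
        √(∏ i ∈ Finset.range d, ((sphereJacobian g v).singularValues i ^ 2 +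
          1 / ((k : ℝ) + 1))) := by
      intro k
      rw [Real.exp_sum]
      congr 1
      refine Finset.prod_congr rfl fun i _ => Real.exp_log ?_
      positivity
    simp only [h]
    have h2 : ∏ i ∈ Finset.range d, (sphereJacobian g v).singularValues i =
        √(∏ i ∈ Finset.range d, ((sphereJacobian g v).singularValues i ^ 2 + 0)) := by
      simp only [add_zero, Finset.prod_pow]
      exact (Real.sqrt_sq (Finset.prod_nonneg fun i _ =>
        LinearMap.singularValues_nonneg _ _)).symm
    rw [h2]
    exact (tendsto_finsetProd _ fun i _ =>
      tendsto_const_nhds.add tendsto_one_div_add_atTop_nhds_zero_nat).sqrt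

end Measurability

/-! ### Surface measure and the area inequality between spheres. -/

section SphereArea

variable {n : ℕ}

/-- The radial projection onto the sphere of radius `c`. -/
noncomputable def radialProj (c : ℝ) (z : EuclideanSpace ℝ (Fin n)) : EuclideanSpace ℝ (Fin n) :=
  (c / ‖z‖) • z

theorem measurable_radialProj (c : ℝ) : Measurable (radialProj (n := n) c) := by
  unfold radialProj
  fun_prop

theorem norm_radialProj {c : ℝ} (hc : 0 < c) {z : EuclideanSpace ℝ (Fin n)} (hz : z ≠ 0) :
    ‖radialProj c z‖ = c := by
  have : ‖z‖ ≠ 0 := norm_ne_zero_iff.2 hz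
  rw [radialProj, norm_smul, norm_div, norm_norm, Real.norm_of_nonneg hc.le]
  field_simp

/-- The surface measure of a sphere is the scaled image of Lebesgue measure on the unit ball under
the radial projection. -/
theorem sphereMeasure_eq_map_radialProj (c : ℝ) :
    sphereMeasure n c = (ENNReal.ofReal (c ^ (n - 1)) * n) •
      Measure.map (radialProj c) (volume.restrict (Metric.ball 0 1 \ {0})) := by
  have hm : Measurable fun u : Metric.sphere (0 : EuclideanSpace ℝ (Fin n)) 1 => c • u.1 :=
    measurable_subtype_coe.const_smul c
  ext s hs
  rw [sphereMeasure, Measure.smul_apply, Measure.smul_apply, Measure.map_apply hm hs,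
    Measure.toSphere_apply' _ (hm hs), Measure.map_apply (measurable_radialProj c) hs,
    Measure.restrict_apply (measurable_radialProj c hs), smul_eq_mul, smul_eq_mul, mul_assoc,
    finrank_euclideanSpace_fin]
  congr 3
  -- `toSphere` measures a set by the volume of the cone over it in the unit ball; this cone is the
  -- radial preimage in the punctured ball.
  ext z
  simp only [Set.mem_smul, Set.mem_Ioo, Set.mem_image, Set.mem_preimage, Set.mem_inter_iff,
    Set.mem_sdiff, Metric.mem_ball, dist_zero_right, Set.mem_singleton_iff, radialProj]
  constructor
  · rintro ⟨r, ⟨hr0, hr1⟩, _, ⟨u, hu, rfl⟩, rfl⟩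
    have hu1 : ‖(u : EuclideanSpace ℝ (Fin n))‖ = 1 := by simp
    have hn : ‖r • (u : EuclideanSpace ℝ (Fin n))‖ = r := by
      rw [norm_smul, hu1, Real.norm_of_nonneg hr0.le, mul_one]
    refine ⟨?_, by rwa [hn], fun h => hr0.ne' (by rw [← hn, h, norm_zero])⟩
    rw [hn, smul_smul, div_mul_cancel₀ _ hr0.ne']
    exact hu
  · rintro ⟨hs, h1, h0⟩
    have hz : ‖z‖ ≠ 0 := norm_ne_zero_iff.2 h0
    refine ⟨‖z‖, ⟨by positivity, h1⟩, ‖z‖⁻¹ • z, ⟨⟨‖z‖⁻¹ • z, ?_⟩, ?_, rfl⟩, ?_⟩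
    · simp [norm_smul, hz]
    · simpa [smul_smul, div_eq_mul_inv] using hs
    · simp [smul_smul, hz]

instance isFiniteMeasure_sphereMeasure (n : ℕ) (c : ℝ) : IsFiniteMeasure (sphereMeasure n c) := by
  refine ⟨?_⟩
  rw [sphereMeasure, Measure.smul_apply, smul_eq_mul]
  exact ENNReal.mul_lt_top ENNReal.ofReal_lt_top (measure_lt_top _ _)

theorem ae_norm_sphereMeasure {c : ℝ} (hc : 0 < c) : ∀ᵐ v ∂(sphereMeasure n c), ‖v‖ = c := by
  rw [sphereMeasure_eq_map_radialProj]
  refine Measure.ae_smul_measure ?_ _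
  rw [ae_map_iff (measurable_radialProj c).aemeasurable
    (measurableSet_eq_fun measurable_norm measurable_const)]
  filter_upwards [ae_restrict_mem (Metric.isOpen_ball.measurableSet.diff
    (measurableSet_singleton 0))] with z hz
  exact norm_radialProj hc hz.2

theorem ae_ne_zero_sphereMeasure {c : ℝ} (hc : 0 < c) : ∀ᵐ v ∂(sphereMeasure n c), v ≠ 0 := by
  filter_upwards [ae_norm_sphereMeasure hc] with v hv
  rintro rfl
  exact hc.ne (by simpa using hv)

theorem hasFDerivAt_norm_of_ne_zero {z : EuclideanSpace ℝ (Fin n)} (hz : z ≠ 0) :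
    HasFDerivAt (fun z : EuclideanSpace ℝ (Fin n) => ‖z‖) (‖z‖⁻¹ • innerSL ℝ z) z := by
  have h := (hasStrictFDerivAt_norm_sq z).hasFDerivAt.sqrt
    (pow_ne_zero 2 (norm_ne_zero_iff.2 hz))
  simp only [Real.sqrt_sq (norm_nonneg _)] at h
  have heq : (1 / (2 * ‖z‖)) • 2 • innerSL ℝ z = ‖z‖⁻¹ • innerSL ℝ z := by
    rw [← Nat.cast_smul_eq_nsmul ℝ, smul_smul]
    congr 1
    push_cast
    field_simp
  rwa [heq] at h

/-- The projection is constant along rays; orthogonally to `z` the norm is stationary, so only the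
scaling factor contributes. -/
theorem hasFDerivAt_radialProj (c : ℝ) {z : EuclideanSpace ℝ (Fin n)} (hz : z ≠ 0) :
    ∃ N' : EuclideanSpace ℝ (Fin n) →L[ℝ] EuclideanSpace ℝ (Fin n),
      HasFDerivAt (radialProj c) N' z ∧ N' z = 0 ∧
        ∀ w, inner ℝ z w = 0 → N' w = (c / ‖z‖) • w := by
  have hz' : ‖z‖ ≠ 0 := norm_ne_zero_iff.2 hz
  have h := (((hasDerivAt_inv hz').comp_hasFDerivAt z (hasFDerivAt_norm_of_ne_zero hz)).const_mul
    c).smul (hasFDerivAt_id z)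
  refine ⟨_, h, ?_, fun w hw => ?_⟩
  · simp only [Function.comp_apply, id_eq, add_apply,
      smul_apply, ContinuousLinearMap.smulRight_apply, innerSL_apply_apply,
      real_inner_self_eq_norm_sq, ContinuousLinearMap.id_apply, ← add_smul, smul_eq_mul]
    convert zero_smul ℝ z
    field_simp
    ring
  · simp [hw, div_eq_mul_inv]

/-- The homogeneous extension of a map between spheres. -/
noncomputable def radialExt (F : EuclideanSpace ℝ (Fin n) → EuclideanSpace ℝ (Fin n))
    (a b : ℝ) (z : EuclideanSpace ℝ (Fin n)) : EuclideanSpace ℝ (Fin n) :=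
  (‖z‖ / b) • F (radialProj a z)

/-- The derivative of the homogeneous extension in the radial and in the tangential directions. -/
theorem exists_hasFDerivAt_radialExt
    {F : EuclideanSpace ℝ (Fin n) → EuclideanSpace ℝ (Fin n)} {a b : ℝ}
    {z : EuclideanSpace ℝ (Fin n)} (hz : z ≠ 0) (hF : DifferentiableAt ℝ F (radialProj a z)) :
    ∃ M : EuclideanSpace ℝ (Fin n) →L[ℝ] EuclideanSpace ℝ (Fin n),
      HasFDerivAt (radialExt F a b) M z ∧
      M (‖z‖⁻¹ • z) = b⁻¹ • F (radialProj a z) ∧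
      ∀ w, inner ℝ z w = 0 → M w = (a / b) • fderiv ℝ F (radialProj a z) w := by
  have hz' : ‖z‖ ≠ 0 := norm_ne_zero_iff.2 hz
  obtain ⟨N', hN, hNz, hNw⟩ := hasFDerivAt_radialProj a hz
  have h := ((hasFDerivAt_norm_of_ne_zero hz).mul_const b⁻¹).smul (hF.hasFDerivAt.comp z hN)
  refine ⟨_, h, ?_, fun w hw => ?_⟩
  · simp [hNz, smul_smul]
    congr 1
    field_simp
  · simp [hNw w hw, hw, smul_smul]
    congr 1
    field_simp

/-- The area of the image of a compact subset of a sphere under a differentiable map into a sphere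
is at most the integral of the product of the singular values of the Jacobian. -/
theorem sphereMeasure_image_le {d : ℕ}
    {F : EuclideanSpace ℝ (Fin (d + 1)) → EuclideanSpace ℝ (Fin (d + 1))} {a b : ℝ}
    (ha : 0 < a) (hb : 0 < b) {K : Set (EuclideanSpace ℝ (Fin (d + 1)))} (hK : IsCompact K)
    (hKa : ∀ v ∈ K, ‖v‖ = a) (hKb : ∀ v ∈ K, ‖F v‖ = b)
    (hF : ∀ v ∈ K, DifferentiableAt ℝ F v) :
    sphereMeasure (d + 1) b (F '' K) ≤
      ∫⁻ v in K, ENNReal.ofReal (∏ i ∈ Finset.range d, (sphereJacobian F v).singularValues i)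
        ∂(sphereMeasure (d + 1) a) := by
  set D : EuclideanSpace ℝ (Fin (d + 1)) → ℝ := fun v =>
    ∏ i ∈ Finset.range d, (sphereJacobian F v).singularValues i with hD
  have hFc : ContinuousOn F K := fun v hv => (hF v hv).continuousAt.continuousWithinAt
  have hFK : MeasurableSet (F '' K) := (hK.image_of_continuousOn hFc).measurableSet
  have hball : MeasurableSet (Metric.ball (0 : EuclideanSpace ℝ (Fin (d + 1))) 1 \ {0}) :=
    Metric.isOpen_ball.measurableSet.diff (measurableSet_singleton 0)
  set S : Set (EuclideanSpace ℝ (Fin (d + 1))) :=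
    radialProj a ⁻¹' K ∩ (Metric.ball 0 1 \ {0}) with hS
  have hSm : MeasurableSet S := (measurable_radialProj a hK.measurableSet).inter hball
  -- The extension preserves norms on `S`: its derivative sends the radial unit vector to a unit
  -- vector and acts tangentially as `a / b` times the Jacobian, which gives the bound on the
  -- determinant.
  have hex : ∀ z, ∃ M : EuclideanSpace ℝ (Fin (d + 1)) →L[ℝ] EuclideanSpace ℝ (Fin (d + 1)),
      z ∈ S → HasFDerivAt (radialExt F a b) M z ∧
        |M.det| ≤ (a / b) ^ d * D (radialProj a z) := by
    intro z
    by_cases hz : z ∈ S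
    swap
    · exact ⟨0, fun h => absurd h hz⟩
    have hz0 : z ≠ 0 := hz.2.2
    have hz' : 0 < ‖z‖ := norm_pos_iff.2 hz0
    obtain ⟨M, hM, hMz, hMw⟩ := exists_hasFDerivAt_radialExt (b := b) hz0 (hF _ hz.1)
    refine ⟨M, fun _ => ⟨hM, ?_⟩⟩
    have hperp : ∀ w ∈ sphereTangent (radialProj a z), inner ℝ z w = 0 := by
      intro w hw
      rw [Submodule.mem_orthogonal_singleton_iff_inner_right, radialProj, inner_smul_left] at hw
      exact (mul_eq_zero.1 hw).resolve_left (by simpa using ⟨ha.ne', hz0⟩)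
    have h := abs_det_le_norm_mul_prod_singularValues (M : _ →ₗ[ℝ] _) (‖z‖⁻¹ • z)
      (radialProj a z) (norm_ne_zero_iff.1 (by rw [norm_radialProj ha hz0]; exact ha.ne'))
      (by rw [norm_smul, norm_inv, norm_norm, inv_mul_cancel₀ hz'.ne'])
      (fun w hw => by rw [inner_smul_left, hperp w hw, mul_zero])
      (sphereJacobian F (radialProj a z)) (a / b)
      (fun w => by
        rw [ContinuousLinearMap.coe_coe, hMw _ (hperp _ w.2), norm_smul,
          Real.norm_of_nonneg (by positivity)]
        rfl)
    have h1 : ‖M (‖z‖⁻¹ • z)‖ = 1 := by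
      rw [hMz, norm_smul, norm_inv, Real.norm_of_nonneg hb.le, hKb _ hz.1, inv_mul_cancel₀ hb.ne']
    rw [ContinuousLinearMap.coe_coe, h1, one_mul] at h
    exact h
  choose M hM using hex
  -- If `y` lies over `F v`, the point of norm `‖y‖` on the ray through `v` is mapped to `y`.
  have hsub : radialProj b ⁻¹' (F '' K) ∩ (Metric.ball 0 1 \ {0}) ⊆ radialExt F a b '' S := by
    rintro y ⟨⟨v, hv, hvy⟩, hy1, hy0⟩
    have hy0 : y ≠ 0 := hy0
    have hy' : 0 < ‖y‖ := norm_pos_iff.2 hy0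
    have hn : ‖(‖y‖ / a) • v‖ = ‖y‖ := by
      rw [norm_smul, hKa v hv, norm_div, norm_norm, Real.norm_of_nonneg ha.le]
      field_simp
    have hN : radialProj a ((‖y‖ / a) • v) = v := by
      rw [radialProj, hn, smul_smul]
      convert one_smul ℝ v
      field_simp
    refine ⟨(‖y‖ / a) • v, ⟨?_, ?_, ?_⟩, ?_⟩
    · rwa [Set.mem_preimage, hN]
    · simpa [hn] using hy1
    · exact norm_ne_zero_iff.1 (by rw [hn]; exact hy'.ne')
    · rw [radialExt, hn, hN, hvy, radialProj, smul_smul]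
      convert one_smul ℝ y
      field_simp
  have hvol : volume (radialProj b ⁻¹' (F '' K) ∩ (Metric.ball 0 1 \ {0})) ≤
      ENNReal.ofReal ((a / b) ^ d) * ∫⁻ z in S, ENNReal.ofReal (D (radialProj a z)) := by
    refine (measure_mono hsub).trans <| (addHaar_image_le_lintegral_abs_det_fderiv volume hSm
      fun z hz => (hM z hz).1.hasFDerivWithinAt).trans ?_
    rw [← lintegral_const_mul' _ _ ENNReal.ofReal_ne_top]
    refine setLIntegral_mono' hSm fun z hz => ?_
    rw [← ENNReal.ofReal_mul (by positivity)]
    exact ENNReal.ofReal_le_ofReal (hM z hz).2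
  have hDm : AEMeasurable (K.indicator fun v => ENNReal.ofReal (D v))
      (Measure.map (radialProj a) (volume.restrict (Metric.ball 0 1 \ {0}))) := by
    refine (aemeasurable_prod_singularValues_sphereJacobian rfl F ?_).ennreal_ofReal.indicator
      hK.measurableSet
    refine (ae_map_iff (p := fun v => v ≠ 0) (measurable_radialProj a).aemeasurable
      (measurableSet_singleton 0).compl).2 ?_
    filter_upwards [ae_restrict_mem hball] with z hz
    exact norm_ne_zero_iff.1 (by rw [norm_radialProj ha hz.2]; exact ha.ne')
  have hint : ∫⁻ v in K, ENNReal.ofReal (D v) ∂(sphereMeasure (d + 1) a) =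
      (ENNReal.ofReal (a ^ d) * ((d + 1 : ℕ) : ℝ≥0∞)) *
        ∫⁻ z in S, ENNReal.ofReal (D (radialProj a z)) := by
    rw [← lintegral_indicator hK.measurableSet, sphereMeasure_eq_map_radialProj,
      lintegral_smul_measure, lintegral_map' hDm (measurable_radialProj a).aemeasurable,
      hS, ← Measure.restrict_restrict (measurable_radialProj a hK.measurableSet),
      ← lintegral_indicator (measurable_radialProj a hK.measurableSet)]
    rfl
  rw [hint, sphereMeasure_eq_map_radialProj, Measure.smul_apply,
    Measure.map_apply (measurable_radialProj b) hFK,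
    Measure.restrict_apply (measurable_radialProj b hFK), smul_eq_mul]
  -- The constants match because `b ^ d * (a / b) ^ d = a ^ d`.
  refine (mul_le_mul_right hvol _).trans_eq ?_
  rw [← mul_assoc]
  congr 1
  rw [mul_right_comm, ← ENNReal.ofReal_mul (by positivity)]
  congr 2
  simp only [Nat.add_sub_cancel]
  rw [← mul_pow, mul_div_cancel₀ _ hb.ne']

end SphereArea

/-! ### Comparison of densities, and Jensen's inequality. -/

section Densities

variable {Ω : Type*} [MeasurableSpace Ω] {P : Measure Ω}

/-- The law of `X` gives no mass to the zero set of its density. This keeps logarithms and negative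
powers of densities away from their default values. -/
theorem ae_pdf_ne_zero_and_ne_top {E : Type*} [MeasurableSpace E] [IsFiniteMeasure P]
    (X : Ω → E) (ν : Measure E) [HasPDF X P ν] :
    ∀ᵐ ω ∂P, pdf X P ν (X ω) ≠ 0 ∧ pdf X P ν (X ω) ≠ ∞ := by
  refine ae_of_ae_map (HasPDF.aemeasurable X P ν)
    (p := fun v => pdf X P ν v ≠ 0 ∧ pdf X P ν v ≠ ∞) ?_
  rw [map_eq_withDensity_pdf X P ν, ae_withDensity_iff (measurable_pdf X P ν)]
  have hlt : ∀ᵐ v ∂ν, pdf X P ν v < ∞ := pdf.ae_lt_top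
  filter_upwards [hlt] with v hv h0
  exact ⟨h0, hv.ne⟩

variable {d : ℕ} {F : EuclideanSpace ℝ (Fin (d + 1)) → EuclideanSpace ℝ (Fin (d + 1))}
  {X : Ω → EuclideanSpace ℝ (Fin (d + 1))} {a b : ℝ}

/-- On a compact set where the density of the output is less than `R`, the distribution of the
input is bounded by `R` times the integral of the product of the singular values. -/
theorem map_le_mul_lintegral_prod_singularValues (ha : 0 < a) (hb : 0 < b)
    [hX : HasPDF X P (sphereMeasure (d + 1) a)]
    [hY : HasPDF (fun ω => F (X ω)) P (sphereMeasure (d + 1) b)]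
    {K : Set (EuclideanSpace ℝ (Fin (d + 1)))} (hK : IsCompact K)
    (hKa : ∀ v ∈ K, ‖v‖ = a) (hKb : ∀ v ∈ K, ‖F v‖ = b)
    (hF : ∀ v ∈ K, DifferentiableAt ℝ F v) (R : ℝ≥0∞)
    (hR : ∀ v ∈ K, pdf (fun ω => F (X ω)) P (sphereMeasure (d + 1) b) (F v) ≤ R) :
    P.map X K ≤ R * ∫⁻ v in K,
      ENNReal.ofReal (∏ i ∈ Finset.range d, (sphereJacobian F v).singularValues i)
        ∂(sphereMeasure (d + 1) a) := by
  have hFc : ContinuousOn F K := fun v hv => (hF v hv).continuousAt.continuousWithinAt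
  have hFK : MeasurableSet (F '' K) := (hK.image_of_continuousOn hFc).measurableSet
  calc P.map X K = P (X ⁻¹' K) :=
        Measure.map_apply_of_aemeasurable (HasPDF.aemeasurable X P (sphereMeasure (d + 1) a)) hK.measurableSet
    -- Only an inequality: points outside `K` may also map into `F '' K`. This is why injectivity is
    -- not needed.
    _ ≤ P ((fun ω => F (X ω)) ⁻¹' (F '' K)) :=
        measure_mono fun ω hω => Set.mem_image_of_mem F hω
    _ = P.map (fun ω => F (X ω)) (F '' K) :=
        (Measure.map_apply_of_aemeasurable
          (HasPDF.aemeasurable _ P (sphereMeasure (d + 1) b)) hFK).symm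
    _ = ∫⁻ y in F '' K, pdf (fun ω => F (X ω)) P (sphereMeasure (d + 1) b) y
          ∂(sphereMeasure (d + 1) b) := map_eq_setLIntegral_pdf _ P _ hFK
    _ ≤ ∫⁻ _ in F '' K, R ∂(sphereMeasure (d + 1) b) := by
        refine setLIntegral_mono' hFK ?_
        rintro _ ⟨v, hv, rfl⟩
        exact hR v hv
    _ = R * sphereMeasure (d + 1) b (F '' K) := setLIntegral_const _ _
    _ ≤ _ := mul_le_mul_right (sphereMeasure_image_le ha hb hK hKa hKb hF) R

/-- Change of variables for a map that need not be injective: the density of the input is at most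
the density of the output times the product of the singular values of the Jacobian. -/
theorem ae_pdf_le_pdf_mul_prod_singularValues [IsFiniteMeasure P] (ha : 0 < a) (hb : 0 < b)
    [hX : HasPDF X P (sphereMeasure (d + 1) a)]
    [hY : HasPDF (fun ω => F (X ω)) P (sphereMeasure (d + 1) b)]
    (hF : ∀ᵐ ω ∂P, DifferentiableAt ℝ F (X ω))
    (hXa : ∀ᵐ ω ∂P, ‖X ω‖ = a) (hYb : ∀ᵐ ω ∂P, ‖F (X ω)‖ = b) :
    ∀ᵐ ω ∂P, pdf X P (sphereMeasure (d + 1) a) (X ω) ≤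
      pdf (fun ω => F (X ω)) P (sphereMeasure (d + 1) b) (F (X ω)) *
        ENNReal.ofReal (∏ i ∈ Finset.range d, (sphereJacobian F (X ω)).singularValues i) := by
  set σ := sphereMeasure (d + 1) a
  set p := pdf X P σ with hp
  set q := pdf (fun ω => F (X ω)) P (sphereMeasure (d + 1) b) with hq
  set D : EuclideanSpace ℝ (Fin (d + 1)) → ℝ≥0∞ := fun v =>
    ENNReal.ofReal (∏ i ∈ Finset.range d, (sphereJacobian F v).singularValues i) with hD
  classical
  set U := {v | DifferentiableAt ℝ F v} with hU
  have hUm : MeasurableSet U := measurableSet_of_differentiableAt ℝ F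
  -- `F` itself need not be measurable, but it is continuous on the measurable set `U` of its points
  -- of differentiability.
  set F' : EuclideanSpace ℝ (Fin (d + 1)) → EuclideanSpace ℝ (Fin (d + 1)) :=
    U.piecewise F 0 with hF'
  have hF'm : Measurable F' := by
    have hc : ContinuousOn F U := fun v hv =>
      (DifferentiableAt.continuousAt (𝕜 := ℝ) hv).continuousWithinAt
    exact hc.measurable_piecewise continuousOn_const hUm
  have hF'U : ∀ v ∈ U, F' v = F v := fun v hv => Set.piecewise_eq_of_mem _ _ _ hv
  let T : ℝ≥0∞ → Set (EuclideanSpace ℝ (Fin (d + 1))) := fun R =>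
    U ∩ {v | ‖v‖ = a ∧ ‖F' v‖ = b ∧ q (F' v) < R}
  have hTm : ∀ R, MeasurableSet (T R) := fun R => hUm.inter <|
    (measurableSet_eq_fun measurable_norm measurable_const).inter <|
    (measurableSet_eq_fun hF'm.norm measurable_const).inter <|
    measurableSet_lt ((measurable_pdf _ _ _).comp hF'm) measurable_const
  have hmain : ∀ R, ∀ᵐ v ∂σ, v ∈ T R → p v ≤ R * D v := by
    intro R
    rw [← ae_restrict_iff' (hTm R)]
    -- Comparing integrals over all measurable `s` suffices, and inner regularity of the law of `X`
    -- reduces these to compact sets, on which the previous bound applies.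
    refine ae_le_of_forall_setLIntegral_le_of_sigmaFinite (measurable_pdf _ _ _) fun s hs _ => ?_
    rw [Measure.restrict_restrict hs, ← map_eq_setLIntegral_pdf X P σ (hs.inter (hTm R)),
      (hs.inter (hTm R)).measure_eq_iSup_isCompact]
    refine iSup₂_le fun K hKC => iSup_le fun hK => ?_
    refine (map_le_mul_lintegral_prod_singularValues ha hb hK (fun v hv => (hKC hv).2.2.1)
      (fun v hv => ?_) (fun v hv => (hKC hv).2.1) R (fun v hv => ?_)).trans ?_
    · rw [← hF'U v (hKC hv).2.1]
      exact (hKC hv).2.2.2.1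
    · rw [← hF'U v (hKC hv).2.1]
      exact (hKC hv).2.2.2.2.le
    · refine (mul_le_mul_right (lintegral_mono_set hKC) R).trans ?_
      exact lintegral_const_mul_le _ _
  have hall : ∀ᵐ ω ∂P, ∀ r : ℚ, X ω ∈ T ((r : ℝ).toNNReal) →
      p (X ω) ≤ ((r : ℝ).toNNReal : ℝ≥0∞) * D (X ω) :=
    ae_of_ae_map (HasPDF.aemeasurable X P σ) (p := fun v => ∀ r : ℚ, v ∈ T ((r : ℝ).toNNReal) →
      p v ≤ ((r : ℝ).toNNReal : ℝ≥0∞) * D v)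
      (hX.absolutelyContinuous'.ae_le (ae_all_iff.2 fun r => hmain _))
  filter_upwards [hall, hF, hXa, hYb,
    ae_pdf_ne_zero_and_ne_top (fun ω => F (X ω)) (sphereMeasure (d + 1) b)] with ω h hd hna hnb hfin
  have hT : ∀ R, q (F (X ω)) < R → X ω ∈ T R := fun R hR => by
    refine ⟨hd, hna, ?_, ?_⟩ <;> rw [hF'U _ hd] <;> assumption
  -- Were the claim false, a rational `r` strictly between `q (F (X ω))` and `p (X ω) / D (X ω)`
  -- would contradict `h`. If `D (X ω) = 0`, any `r` above the finite number `q (F (X ω))` forces `p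
  -- (X ω) = 0`.
  by_contra! hlt
  have hlt' : q (F (X ω)) < p (X ω) / D (X ω) ∨ D (X ω) = 0 := by
    by_cases h0 : D (X ω) = 0
    · exact Or.inr h0
    · exact Or.inl ((ENNReal.lt_div_iff_mul_lt (Or.inl h0) (Or.inl ENNReal.ofReal_ne_top)).2 hlt)
  rcases hlt' with hlt' | h0
  · obtain ⟨r, -, hr1, hr2⟩ := ENNReal.lt_iff_exists_rat_btwn.1 hlt'
    exact absurd (h r (hT _ hr1)) (not_le.2 (ENNReal.mul_lt_of_lt_div hr2))
  · obtain ⟨r, -, hr1, -⟩ := ENNReal.lt_iff_exists_rat_btwn.1 (lt_top_iff_ne_top.2 hfin.2)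
    have := h r (hT _ hr1)
    rw [h0, mul_zero] at this
    exact absurd hlt (not_lt.2 (this.trans zero_le))

/-- Jensen's inequality for the exponential, with the expectation on the right in `[0, ∞]`. -/
theorem ofReal_exp_integral_le_lintegral [IsProbabilityMeasure P] {f : Ω → ℝ}
    (hf : Integrable f P) :
    ENNReal.ofReal (Real.exp (∫ ω, f ω ∂P)) ≤ ∫⁻ ω, ENNReal.ofReal (Real.exp (f ω)) ∂P := by
  by_cases h : Integrable (fun ω => Real.exp (f ω)) P
  · rw [← ofReal_integral_eq_lintegral_ofReal h
      (Filter.Eventually.of_forall fun ω => (Real.exp_pos _).le)]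
    exact ENNReal.ofReal_le_ofReal <| convexOn_exp.map_integral_le
      Real.continuous_exp.continuousOn isClosed_univ (by simp) hf h
  · have hm : AEStronglyMeasurable (fun ω => Real.exp (f ω)) P :=
      Real.continuous_exp.comp_aestronglyMeasurable hf.1
    have : ∫⁻ ω, ENNReal.ofReal (Real.exp (f ω)) ∂P = ∞ := by
      by_contra hne
      refine h ⟨hm, ?_⟩
      rw [hasFiniteIntegral_iff_ofReal (Filter.Eventually.of_forall fun ω => (Real.exp_pos _).le)]
      exact lt_top_iff_ne_top.2 hne
    rw [this]
    exact le_top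

end Densities

/-! ### Entropy bounds and the gain from spread. -/

section Bounds

variable {Ω : Type*} [MeasurableSpace Ω] {P : Measure Ω} {d : ℕ}
  {F : EuclideanSpace ℝ (Fin (d + 1)) → EuclideanSpace ℝ (Fin (d + 1))}
  {X : Ω → EuclideanSpace ℝ (Fin (d + 1))} {a b : ℝ}

/-- The entropy bound for the mean of the singular values. -/
theorem exp_entropy_sub_le_lintegral_meanSV [IsProbabilityMeasure P]
    (hd : 0 < d) (ha : 0 < a) (hb : 0 < b)
    [HasPDF X P (sphereMeasure (d + 1) a)]
    [HasPDF (fun ω => F (X ω)) P (sphereMeasure (d + 1) b)]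
    (hF : ∀ᵐ ω ∂P, DifferentiableAt ℝ F (X ω))
    (hXa : ∀ᵐ ω ∂P, ‖X ω‖ = a) (hYb : ∀ᵐ ω ∂P, ‖F (X ω)‖ = b)
    (hEX : HasEntropy X P (sphereMeasure (d + 1) a))
    (hEY : HasEntropy (fun ω => F (X ω)) P (sphereMeasure (d + 1) b)) :
    ENNReal.ofReal (Real.exp (1 / d * (entropy (fun ω => F (X ω)) P (sphereMeasure (d + 1) b) -
      entropy X P (sphereMeasure (d + 1) a)))) ≤
      ∫⁻ ω, ENNReal.ofReal (meanSV (sphereJacobian F (X ω))) ∂P := by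
  have hint := (hEY.sub hEX).const_mul (1 / (d : ℝ))
  have h := ofReal_exp_integral_le_lintegral hint
  rw [integral_const_mul, integral_sub' hEY hEX] at h
  refine h.trans (lintegral_mono_ae ?_)
  filter_upwards [ae_pdf_le_pdf_mul_prod_singularValues ha hb hF hXa hYb, hXa,
    ae_pdf_ne_zero_and_ne_top X (sphereMeasure (d + 1) a),
    ae_pdf_ne_zero_and_ne_top (fun ω => F (X ω)) (sphereMeasure (d + 1) b)]
    with ω hle hna ⟨hp0, hpt⟩ ⟨hq0, hqt⟩
  have hX0 : X ω ≠ 0 := norm_ne_zero_iff.1 (by rw [hna]; exact ha.ne')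
  refine ENNReal.ofReal_le_ofReal (le_trans ?_
    (prod_singularValues_rpow_le_meanSV _ hd (finrank_sphereTangent rfl hX0)))
  have hD0 : 0 ≤ ∏ i ∈ Finset.range d, (sphereJacobian F (X ω)).singularValues i :=
    Finset.prod_nonneg fun i _ => LinearMap.singularValues_nonneg _ _
  have hle' := ENNReal.toReal_mono (ENNReal.mul_ne_top hqt ENNReal.ofReal_ne_top) hle
  rw [ENNReal.toReal_mul, ENNReal.toReal_ofReal hD0] at hle'
  have hp := ENNReal.toReal_pos hp0 hpt
  have hq := ENNReal.toReal_pos hq0 hqt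
  -- A positive input density forces a positive product, so its logarithm is genuine.
  have hD : 0 < ∏ i ∈ Finset.range d, (sphereJacobian F (X ω)).singularValues i :=
    pos_of_mul_pos_right (hp.trans_le hle') hq.le
  rw [Real.rpow_def_of_pos hD, mul_comm (Real.log _)]
  refine Real.exp_le_exp.2 (mul_le_mul_of_nonneg_left ?_ (by positivity))
  have hlog := Real.log_le_log hp hle'
  rw [Real.log_mul hq.ne' hD.ne'] at hlog
  simp only [Pi.sub_apply, infoContent]
  linarith

/-- The exponential entropy bound for the mean of the singular values. -/
theorem expEntropy_le_mul_lintegral_meanSV [IsProbabilityMeasure P]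
    (hd : 0 < d) (ha : 0 < a) (hb : 0 < b)
    [hX : HasPDF X P (sphereMeasure (d + 1) a)]
    [HasPDF (fun ω => F (X ω)) P (sphereMeasure (d + 1) b)]
    (hF : ∀ᵐ ω ∂P, DifferentiableAt ℝ F (X ω))
    (hXa : ∀ᵐ ω ∂P, ‖X ω‖ = a) (hYb : ∀ᵐ ω ∂P, ‖F (X ω)‖ = b)
    (hind : IndepFun (fun ω => pdf X P (sphereMeasure (d + 1) a) (X ω))
      (fun ω (i : ℕ) => (sphereJacobian F (X ω)).singularValues i) P) :
    expEntropy d (fun ω => F (X ω)) P (sphereMeasure (d + 1) b) ≤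
      (∫⁻ ω, ENNReal.ofReal (meanSV (sphereJacobian F (X ω))) ∂P) *
        expEntropy d X P (sphereMeasure (d + 1) a) := by
  have hXm : AEMeasurable X P := HasPDF.aemeasurable X P (sphereMeasure (d + 1) a)
  have hd' : 0 < 1 / (d : ℝ) := by positivity
  let D : Ω → ℝ := fun ω => ∏ i ∈ Finset.range d, (sphereJacobian F (X ω)).singularValues i
  -- Factoring the expectation needs measurability, which independence alone does not supply.
  have hDm : AEMeasurable D P :=
    (aemeasurable_prod_singularValues_sphereJacobian rfl F
      (hX.absolutelyContinuous'.ae_le (ae_ne_zero_sphereMeasure ha))).comp_aemeasurable hXm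
  have hind' : IndepFun (fun ω => pdf X P (sphereMeasure (d + 1) a) (X ω) ^ (-(1 / (d : ℝ))))
      (fun ω => ENNReal.ofReal (D ω) ^ (1 / (d : ℝ))) P := by
    refine hind.comp (φ := fun t : ℝ≥0∞ => t ^ (-(1 / (d : ℝ))))
      (ψ := fun s : ℕ → ℝ => ENNReal.ofReal (∏ i ∈ Finset.range d, s i) ^ (1 / (d : ℝ)))
      (by fun_prop) ?_
    refine Measurable.pow_const (ENNReal.measurable_ofReal.comp ?_) _
    exact Finset.measurable_fun_prod _ fun i _ => measurable_pi_apply i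
  calc expEntropy d (fun ω => F (X ω)) P (sphereMeasure (d + 1) b)
      ≤ ∫⁻ ω, pdf X P (sphereMeasure (d + 1) a) (X ω) ^ (-(1 / (d : ℝ))) *
          ENNReal.ofReal (D ω) ^ (1 / (d : ℝ)) ∂P := by
        refine lintegral_mono_ae ?_
        filter_upwards [ae_pdf_le_pdf_mul_prod_singularValues ha hb hF hXa hYb,
          ae_pdf_ne_zero_and_ne_top X (sphereMeasure (d + 1) a),
          ae_pdf_ne_zero_and_ne_top (fun ω => F (X ω)) (sphereMeasure (d + 1) b)]
          with ω hle ⟨hp0, hpt⟩ ⟨hq0, hqt⟩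
        rw [ENNReal.rpow_neg, ENNReal.rpow_neg, mul_comm, ← div_eq_mul_inv,
          ENNReal.le_div_iff_mul_le (Or.inl (by simp [hp0]))
            (Or.inl (ENNReal.rpow_ne_top_of_nonneg hd'.le hpt)),
          mul_comm, ← div_eq_mul_inv]
        refine ENNReal.div_le_of_le_mul ?_
        rw [← ENNReal.mul_rpow_of_nonneg _ _ hd'.le, mul_comm]
        exact ENNReal.rpow_le_rpow hle hd'.le
    _ = expEntropy d X P (sphereMeasure (d + 1) a) *
          ∫⁻ ω, ENNReal.ofReal (D ω) ^ (1 / (d : ℝ)) ∂P :=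
        lintegral_mul_eq_lintegral_mul_lintegral_of_indepFun'
          (((measurable_pdf X P _).comp_aemeasurable hXm).pow_const _)
          (hDm.ennreal_ofReal.pow_const _) hind'
    _ ≤ _ := by
        rw [mul_comm]
        refine mul_le_mul_left (lintegral_mono_ae ?_) _
        filter_upwards [hXa] with ω hna
        have hX0 : X ω ≠ 0 := norm_ne_zero_iff.1 (by rw [hna]; exact ha.ne')
        rw [ENNReal.ofReal_rpow_of_nonneg
          (Finset.prod_nonneg fun i _ => LinearMap.singularValues_nonneg _ _) hd'.le]
        exact ENNReal.ofReal_le_ofReal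
          (prod_singularValues_rpow_le_meanSV _ hd (finrank_sphereTangent rfl hX0))

/-- A spread of the singular values pushes the gradient scale above the mean singular value. -/
theorem mul_add_lintegral_meanSV_le_lintegral_gsc (hd : 0 < d) (ha : 0 < a) (hb : 0 < b)
    [hX : HasPDF X P (sphereMeasure (d + 1) a)]
    (hXa : ∀ᵐ ω ∂P, ‖X ω‖ = a) (hYb : ∀ᵐ ω ∂P, ‖F (X ω)‖ = b) {ε δ : ℝ} (hε : 0 ≤ ε)
    (hδ : δ ≤ P.real {ω | √(ε * (ε + 2 * meanSV (sphereJacobian F (X ω)))) ≤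
      stdSV (sphereJacobian F (X ω))}) :
    ENNReal.ofReal (a / b) * (ENNReal.ofReal (ε * δ) +
      ∫⁻ ω, ENNReal.ofReal (meanSV (sphereJacobian F (X ω))) ∂P) ≤
      ∫⁻ ω, ENNReal.ofReal (qmNorm (sphereJacobian F (X ω)) * ‖X ω‖ / ‖F (X ω)‖) ∂P := by
  have hXm : AEMeasurable X P := HasPDF.aemeasurable X P (sphereMeasure (d + 1) a)
  have hne : ∀ᵐ v ∂(P.map X), v ≠ 0 :=
    hX.absolutelyContinuous'.ae_le (ae_ne_zero_sphereMeasure ha)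
  have hmean : AEMeasurable (fun ω => meanSV (sphereJacobian F (X ω))) P :=
    (aemeasurable_meanSV_sphereJacobian rfl F hne).comp_aemeasurable hXm
  have hqm : AEMeasurable (fun ω => qmNorm (sphereJacobian F (X ω))) P :=
    (aemeasurable_qmNorm_sphereJacobian rfl F hne).comp_aemeasurable hXm
  set S := {ω | √(ε * (ε + 2 * meanSV (sphereJacobian F (X ω)))) ≤
      stdSV (sphereJacobian F (X ω))} with hS
  have hfin : ∀ᵐ ω ∂P, 0 < Module.finrank ℝ (sphereTangent (X ω)) := by
    filter_upwards [hXa] with ω hna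
    rwa [finrank_sphereTangent rfl (norm_ne_zero_iff.1 (by rw [hna]; exact ha.ne'))]
  -- Rewritten as `ε + meanSV ≤ qmNorm`, the event involves only functions already known to be
  -- measurable.
  have hSm : NullMeasurableSet S P := by
    refine (nullMeasurableSet_le (hmean.const_add ε) hqm).congr ?_
    filter_upwards [hfin] with ω h
    exact propext (sqrt_le_stdSV_iff _ h hε).symm
  have hεδ : ENNReal.ofReal (ε * δ) ≤ ∫⁻ ω, S.indicator (fun _ => ENNReal.ofReal ε) ω ∂P := by
    -- Only `ε` has to be nonnegative here; for negative `δ` the left side becomes `0`.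
    rw [lintegral_indicator_const₀ hSm, ENNReal.ofReal_mul hε]
    refine mul_le_mul_right (ENNReal.ofReal_le_of_le_toReal hδ) _
  calc ENNReal.ofReal (a / b) * (ENNReal.ofReal (ε * δ) +
      ∫⁻ ω, ENNReal.ofReal (meanSV (sphereJacobian F (X ω))) ∂P)
      ≤ ENNReal.ofReal (a / b) * ∫⁻ ω, (S.indicator (fun _ => ENNReal.ofReal ε) ω +
          ENNReal.ofReal (meanSV (sphereJacobian F (X ω)))) ∂P := by
        rw [lintegral_add_left' (aemeasurable_const.indicator₀ hSm)]
        gcongr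
    _ = ∫⁻ ω, ENNReal.ofReal (a / b) * (S.indicator (fun _ => ENNReal.ofReal ε) ω +
          ENNReal.ofReal (meanSV (sphereJacobian F (X ω)))) ∂P :=
        (lintegral_const_mul' _ _ ENNReal.ofReal_ne_top).symm
    _ ≤ _ := by
        refine lintegral_mono_ae ?_
        filter_upwards [hXa, hYb, hfin] with ω hna hnb hV
        have hm := meanSV_nonneg (sphereJacobian F (X ω))
        rw [hna, hnb, mul_div_assoc, mul_comm (qmNorm _), ENNReal.ofReal_mul (by positivity)]
        refine mul_le_mul_right ?_ _
        by_cases hω : ω ∈ S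
        · rw [Set.indicator_of_mem hω, ← ENNReal.ofReal_add hε hm]
          exact ENNReal.ofReal_le_ofReal ((sqrt_le_stdSV_iff _ hV hε).1 hω)
        · rw [Set.indicator_of_notMem hω, zero_add]
          exact ENNReal.ofReal_le_ofReal (meanSV_le_qmNorm _ hV)

/-- The two lower bounds for a map between Euclidean spaces of dimension `d + 1`. -/
theorem entropy_bounds_le_lintegral_gsc [IsProbabilityMeasure P]
    {n m : ℕ} (hn : n = d + 1) (hm : m = d + 1)
    {F : EuclideanSpace ℝ (Fin n) → EuclideanSpace ℝ (Fin m)}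
    {X : Ω → EuclideanSpace ℝ (Fin n)} (hd : 0 < d) (ha : 0 < a) (hb : 0 < b)
    [hX : HasPDF X P (sphereMeasure n a)] [hY : HasPDF (fun ω => F (X ω)) P (sphereMeasure m b)]
    (hF : ∀ᵐ ω ∂P, DifferentiableAt ℝ F (X ω))
    (hXa : ∀ᵐ ω ∂P, ‖X ω‖ = a) (hYb : ∀ᵐ ω ∂P, ‖F (X ω)‖ = b) {ε δ : ℝ} (hε : 0 ≤ ε)
    (hδ : δ ≤ P.real {ω | √(ε * (ε + 2 * meanSV (sphereJacobian F (X ω)))) ≤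
      stdSV (sphereJacobian F (X ω))}) :
    (HasEntropy X P (sphereMeasure n a) →
      HasEntropy (fun ω => F (X ω)) P (sphereMeasure m b) →
      ENNReal.ofReal (a / b * (ε * δ) + Real.exp (1 / d *
        ((entropy (fun ω => F (X ω)) P (sphereMeasure m b) - d * Real.log b) -
          (entropy X P (sphereMeasure n a) - d * Real.log a)))) ≤
        ∫⁻ ω, ENNReal.ofReal (qmNorm (sphereJacobian F (X ω)) * ‖X ω‖ / ‖F (X ω)‖) ∂P) ∧
    (IndepFun (fun ω => pdf X P (sphereMeasure n a) (X ω))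
        (fun ω (i : ℕ) => (sphereJacobian F (X ω)).singularValues i) P →
      ENNReal.ofReal (a / b * (ε * δ)) +
          (expEntropy d (fun ω => F (X ω)) P (sphereMeasure m b) / ENNReal.ofReal b) /
            (expEntropy d X P (sphereMeasure n a) / ENNReal.ofReal a) ≤
        ∫⁻ ω, ENNReal.ofReal (qmNorm (sphereJacobian F (X ω)) * ‖X ω‖ / ‖F (X ω)‖) ∂P) := by
  -- The dimensions are variables up to this point because the widths of a network are not variables
  -- and could not be substituted.
  subst hn hm
  have hgsc := mul_add_lintegral_meanSV_le_lintegral_gsc hd ha hb hXa hYb hε hδ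
  have hab : 0 < a / b := div_pos ha hb
  refine ⟨fun hEX hEY => le_trans ?_ hgsc, fun hind => le_trans ?_ hgsc⟩
  -- The normalising terms `d * log a` and `d * log b` contribute exactly the factor `a / b`.
  · have hexp : Real.exp (1 / d *
        ((entropy (fun ω => F (X ω)) P (sphereMeasure (d + 1) b) - d * Real.log b) -
          (entropy X P (sphereMeasure (d + 1) a) - d * Real.log a))) =
        a / b * Real.exp (1 / d * (entropy (fun ω => F (X ω)) P (sphereMeasure (d + 1) b) -
          entropy X P (sphereMeasure (d + 1) a))) := by
      rw [← Real.exp_log hab, ← Real.exp_add, Real.log_div ha.ne' hb.ne']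
      congr 1
      have : (d : ℝ) ≠ 0 := by positivity
      field_simp
      ring
    rw [hexp, ← mul_add, ENNReal.ofReal_mul hab.le]
    refine mul_le_mul_right (ENNReal.ofReal_add_le.trans ?_) _
    gcongr
    exact exp_entropy_sub_le_lintegral_meanSV hd ha hb hF hXa hYb hEX hEY
  · rw [ENNReal.ofReal_mul hab.le, mul_add]
    gcongr
    -- This rule holds in `[0, ∞]` without side conditions, so exponential entropies equal to `0` or
    -- `∞` need no separate case.
    refine ENNReal.div_le_of_le_mul (ENNReal.div_le_of_le_mul ?_)
    refine (expEntropy_le_mul_lintegral_meanSV hd ha hb hF hXa hYb hind).trans_eq ?_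
    have ha0 : ENNReal.ofReal a ≠ 0 := by simpa using ha
    have hb0 : ENNReal.ofReal b ≠ 0 := by simpa using hb
    rw [ENNReal.ofReal_div_of_pos hb, div_eq_mul_inv, div_eq_mul_inv]
    generalize (∫⁻ ω, ENNReal.ofReal (meanSV (sphereJacobian F (X ω))) ∂P) = M
    generalize expEntropy d X P (sphereMeasure (d + 1) a) = E
    calc M * E = M * E * (ENNReal.ofReal a * (ENNReal.ofReal a)⁻¹) *
          (ENNReal.ofReal b * (ENNReal.ofReal b)⁻¹) := by
          rw [ENNReal.mul_inv_cancel ha0 ENNReal.ofReal_ne_top,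
            ENNReal.mul_inv_cancel hb0 ENNReal.ofReal_ne_top, mul_one, mul_one]
      _ = _ := by ring

end Bounds

/-! ### From a single map to a layer of the network. -/

namespace NeuralNetwork

variable (N : NeuralNetwork)

theorem between_succ_self (θ : ∀ l, N.Param l) (l : ℕ) :
    N.between θ l (l + 1) (Nat.le_succ l) = N.layer l (θ l) := by
  rw [N.between_succ θ l l le_rfl, between_self, Function.id_comp]

/-- The recursion for `between` peels layers off at the input end, whereas the layer `f_l` sits at
the output end; induction on `k` moves it across. -/
theorem between_eq_layer_comp (θ : ∀ l, N.Param l) (l k : ℕ) (h : l + 1 ≤ k) :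
    N.between θ l k ((Nat.le_succ l).trans h) = N.layer l (θ l) ∘ N.between θ (l + 1) k h := by
  induction k, h using Nat.le_induction with
  | base => rw [N.between_self, Function.comp_id]; exact N.between_succ_self θ l
  | succ k hk ih => rw [N.between_succ θ l k ((Nat.le_succ l).trans hk), ih,
      N.between_succ θ (l + 1) k hk, Function.comp_assoc]

end NeuralNetwork

theorem corollary2 {Ω : Type*} [MeasurableSpace Ω] (P : Measure Ω) [IsProbabilityMeasure P]
    -- the network, its fixed parameter and a random data input
    (N : NeuralNetwork) (θ : ∀ l, N.Param l)
    (x : Ω → N.Space (N.depth + 1)) (hx : AEMeasurable x P)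
    -- the layer `f_l`, which acts on `f_{l+1}` and preserves the dimension
    (l : ℕ) (hl : l + 1 ≤ N.depth + 1)
    (d : ℕ) (hd : 1 ≤ d) (hwIn : N.width (l + 1) = d + 1) (hwOut : N.width l = d + 1)
    -- the random activation vectors `f_{l+1}` and `f_l`
    (fIn : Ω → N.Space (l + 1)) (hfIn : ∀ ω, fIn ω = N.act θ (l + 1) hl (x ω))
    (fOut : Ω → N.Space l) (hfOut : ∀ ω, fOut ω = N.act θ l ((Nat.le_succ l).trans hl) (x ω))
    (hdiff : ∀ᵐ ω ∂P, DifferentiableAt ℝ (N.layer l (θ l)) (fIn ω))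
    -- fixed activation lengths
    (cIn cOut : ℝ) (hcIn : 0 < cIn) (hcOut : 0 < cOut)
    (hlenIn : ∀ᵐ ω ∂P, ‖fIn ω‖ = cIn) (hlenOut : ∀ᵐ ω ∂P, ‖fOut ω‖ = cOut)
    -- the activation vectors have densities on their `d`-dimensional hyperspheres
    (hpdfIn : HasPDF fIn P (sphereMeasure (N.width (l + 1)) cIn))
    (hpdfOut : HasPDF fOut P (sphereMeasure (N.width l) cOut))
    -- the Jacobian of `f_l` with respect to `f_{l+1}`, and the spread of its singular values
    (ε δ : ℝ) (hε : 0 ≤ ε)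
    (hδ : δ ≤ P.real {ω |
      √(ε * (ε + 2 * meanSV (N.jacobian θ (l + 1) l (Nat.le_succ l) hl (x ω)))) ≤
        stdSV (N.jacobian θ (l + 1) l (Nat.le_succ l) hl (x ω))}) :
    (HasEntropy fIn P (sphereMeasure (N.width (l + 1)) cIn) →
      HasEntropy fOut P (sphereMeasure (N.width l) cOut) →
      ENNReal.ofReal (cIn / cOut * (ε * δ) +
          Real.exp (1 / d *
            ((entropy fOut P (sphereMeasure (N.width l) cOut) - d * Real.log cOut) -
              (entropy fIn P (sphereMeasure (N.width (l + 1)) cIn) - d * Real.log cIn)))) ≤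
        ∫⁻ ω, ENNReal.ofReal (N.gsc θ (l + 1) l (Nat.le_succ l) hl (x ω)) ∂P) ∧
    (IndepFun
        (fun ω => pdf fIn P (sphereMeasure (N.width (l + 1)) cIn) (fIn ω))
        (fun ω (i : ℕ) => (N.jacobian θ (l + 1) l (Nat.le_succ l) hl (x ω)).singularValues i) P →
      ENNReal.ofReal (cIn / cOut * (ε * δ)) +
          (expEntropy d fOut P (sphereMeasure (N.width l) cOut) / ENNReal.ofReal cOut) /
            (expEntropy d fIn P (sphereMeasure (N.width (l + 1)) cIn) / ENNReal.ofReal cIn) ≤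
        ∫⁻ ω, ENNReal.ofReal (N.gsc θ (l + 1) l (Nat.le_succ l) hl (x ω)) ∂P) := by
  have hout : fOut = fun ω => N.layer l (θ l) (fIn ω) := by
    funext ω
    rw [hfOut, hfIn]
    exact congrFun (N.between_eq_layer_comp θ l (N.depth + 1) hl) (x ω)
  have hgsc : ∀ ω, N.gsc θ (l + 1) l (Nat.le_succ l) hl (x ω) =
      qmNorm (N.jacobian θ (l + 1) l (Nat.le_succ l) hl (x ω)) * ‖fIn ω‖ / ‖fOut ω‖ := fun ω => by
    rw [hfIn, hfOut]
    rfl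
  simp only [hgsc]
  subst hout
  obtain rfl : fIn = fun ω => N.act θ (l + 1) hl (x ω) := funext hfIn
  unfold NeuralNetwork.jacobian at *
  rw [N.between_succ_self θ l] at *
  exact entropy_bounds_le_lintegral_gsc hwIn hwOut hd hcIn hcOut hdiff hlenIn hlenOut hε hδ
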